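/- Let $(a_k)_{k\in\mathbb Z}$ and $(b_k)_{k\in\mathbb Z}$ be real sequences with $a_k>0$ for all $k$. Let $L$ be the doubly infinite Jacobi operator on $\ell^2(\mathbb Z)$ (complex sequences), with standard orthonormal basis $(e_k)_{k\in\mathbb Z}$, defined on the finite linear combinations of the $e_k$ by $$L e_k = a_k e_{k+1}+b_k e_k+a_{k-1}e_{k-1},\qquad k\in\mathbb Z.$$ Let $J^+$ and $J^-$ be the Jacobi operators on $\ell^2(\mathbb Z_{\ge 0})$, with standard orthonormal basis $(f_k)_{k\ge 0}$, defined on the finite linear combinations of the $f_k$ by $$J^+f_k = a_k f_{k+1}+b_k f_k+a_{k-1}f_{k-1}\ (k\ge 1),\qquad J^+f_0=a_0f_1+b_0f_0,$$ $$J^-f_k = a_{-k-2} f_{k+1}+b_{-k-1} f_k+a_{-k-1}f_{k-1}\ (k\ge 1),\qquad J^-f_0=a_{-2}f_1+b_{-1}f_0.$$ For a densely defined symmetric operator $T$ the deficiency indices are the pair $(n_+(T),n_-(T))=(\dim N_i,\dim N_{-i})$, where $N_z=\{v\in\mathcal D(T^*) : T^*v=zv\}$. Then $$n_+(L)=n_+(J^+)+n_+(J^-)\quad\text{and}\quad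 n_-(L)=n_-(J^+)+n_-(J^-).$$ In particular, $L$ is essentially self-adjoint (its closure is self-adjoint) if and only if both $J^+$ and $J^-$ are essentially self-adjoint. -/

import Mathlib

open scoped LinearPMap

/-! ### Deficiency indices and essential self-adjointness -/

section Unbounded

variable {H : Type*} [NormedAddCommGroup H] [InnerProductSpace ℂ H] [CompleteSpace H]

/-- The deficiency space `N_z = {v ∈ D(T†) | T† v = z v}`, as a subspace of `D(T†)`. -/
noncomputable def deficiencySpace (T : H →ₗ.[ℂ] H) (z : ℂ) : Submodule ℂ (T†).domain :=
  LinearMap.ker ((T†).toFun - z • (T†).domain.subtype)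

theorem mem_deficiencySpace (T : H →ₗ.[ℂ] H) (z : ℂ) (v : (T†).domain) :
    v ∈ deficiencySpace T z ↔ T† v = z • (v : H) := by
  change (T†) v - z • (v : H) = 0 ↔ _
  exact sub_eq_zero

/-- The deficiency indices `(n₊, n₋) = (dim N_i, dim N_{-i})`, as a pair of cardinals. -/
noncomputable def deficiencyIndices {H : Type} [NormedAddCommGroup H] [InnerProductSpace ℂ H]
    [CompleteSpace H] (T : H →ₗ.[ℂ] H) : Cardinal.{0} × Cardinal.{0} :=
  (Module.rank ℂ (deficiencySpace T Complex.I), Module.rank ℂ (deficiencySpace T (-Complex.I)))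

/-- `T` is essentially self-adjoint: it is densely defined and symmetric, and its closure is
self-adjoint. -/
structure IsEssentiallySelfAdjoint (T : H →ₗ.[ℂ] H) : Prop where
  dense_domain : Dense (T.domain : Set H)
  symmetric : T.IsFormalAdjoint T
  closure_selfAdjoint : IsSelfAdjoint T.closure

end Unbounded

/-! ### Operators on `ℓ²(ι)` given by their values on the standard basis -/

/-- The complex Hilbert space `ℓ²(ι)` of square summable families. -/
abbrev EllTwo (ι : Type) : Type := lp (fun _ : ι => ℂ) 2

namespace EllTwo

variable {ι : Type} [DecidableEq ι]

/-- The standard orthonormal basis vector `e_k` of `ℓ²(ι)`. -/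
noncomputable def e (k : ι) : EllTwo ι := lp.single 2 k (1 : ℂ)

theorem e_apply (k j : ι) : (e k : ι → ℂ) j = if j = k then 1 else 0 := by
  by_cases h : j = k
  · subst h; simp [e]
  · simp [e, h]

theorem inner_e (v : EllTwo ι) (k : ι) : inner ℂ (e k) v = v k := by
  simp [e, lp.inner_single_left]

theorem orthonormal_e : Orthonormal ℂ (e : ι → EllTwo ι) := by
  rw [orthonormal_iff_ite]
  intro i j
  rw [inner_e, e_apply]

theorem linearIndependent_e : LinearIndependent ℂ (e : ι → EllTwo ι) :=
  orthonormal_e.linearIndependent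

/-- The operator whose domain is the space of finite linear combinations of the basis vectors
`e_k`, and which maps `e_k` to `A k`. -/
noncomputable def opOfBasis (A : ι → EllTwo ι) : EllTwo ι →ₗ.[ℂ] EllTwo ι where
  domain := Submodule.span ℂ (Set.range e)
  toFun := (Module.Basis.span linearIndependent_e).constr ℂ A

theorem e_mem (A : ι → EllTwo ι) (k : ι) : e k ∈ (opOfBasis A).domain :=
  Submodule.subset_span ⟨k, rfl⟩

theorem opOfBasis_e (A : ι → EllTwo ι) (k : ι) : opOfBasis A ⟨e k, e_mem A k⟩ = A k := by
  have h : (⟨e k, e_mem A k⟩ : Submodule.span ℂ (Set.range (e : ι → EllTwo ι)))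
      = Module.Basis.span linearIndependent_e k := by
    apply Subtype.ext
    rw [Module.Basis.span_apply]
  change (Module.Basis.span linearIndependent_e).constr ℂ A ⟨e k, e_mem A k⟩ = A k
  rw [h, Module.Basis.constr_basis]

theorem dense_domain_opOfBasis (A : ι → EllTwo ι) :
    Dense ((opOfBasis A).domain : Set (EllTwo ι)) := by
  change Dense ((Submodule.span ℂ (Set.range (e : ι → EllTwo ι)) : Submodule ℂ (EllTwo ι)) :
    Set (EllTwo ι))
  rw [Submodule.dense_iff_topologicalClosure_eq_top, Submodule.topologicalClosure_eq_top_iff,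
    Submodule.eq_bot_iff]
  intro v hv
  ext k
  rw [← inner_e v k]
  exact (Submodule.mem_orthogonal _ _).1 hv (e k) (Submodule.subset_span ⟨k, rfl⟩)

end EllTwo

open EllTwo in
/-- The Jacobi operator on `ℓ²(ℤ≥0)` with coefficients `a`, `b`:
`J e_0 = a_0 e_1 + b_0 e_0` and `J e_k = a_k e_{k+1} + b_k e_k + a_{k-1} e_{k-1}` for `k ≥ 1`. -/
noncomputable def jacobiHalfLine (a b : ℕ → ℝ) : EllTwo ℕ →ₗ.[ℂ] EllTwo ℕ :=
  opOfBasis fun k => match k with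
    | 0 => (a 0 : ℂ) • e 1 + (b 0 : ℂ) • e 0
    | k + 1 => (a (k + 1) : ℂ) • e (k + 2) + (b (k + 1) : ℂ) • e (k + 1) + (a k : ℂ) • e k

open EllTwo in
/-- The doubly infinite Jacobi operator on `ℓ²(ℤ)` with coefficients `a`, `b`:
`L e_k = a_k e_{k+1} + b_k e_k + a_{k-1} e_{k-1}`. -/
noncomputable def jacobiLine (a b : ℤ → ℝ) : EllTwo ℤ →ₗ.[ℂ] EllTwo ℤ :=
  opOfBasis fun k => (a k : ℂ) • e (k + 1) + (b k : ℂ) • e k + (a (k - 1) : ℂ) • e (k - 1)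

/-- The Jacobi operator `J⁺` of `L`:
`J⁺ f_k = a_k f_{k+1} + b_k f_k + a_{k-1} f_{k-1}`, without the last term for `k = 0`. -/
noncomputable def jacobiPlus (a b : ℤ → ℝ) : EllTwo ℕ →ₗ.[ℂ] EllTwo ℕ :=
  jacobiHalfLine (fun k => a (k : ℤ)) (fun k => b (k : ℤ))

/-- The Jacobi operator `J⁻` of `L`:
`J⁻ f_k = a_{-k-2} f_{k+1} + b_{-k-1} f_k + a_{-k-1} f_{k-1}`, without the last term for
`k = 0`. -/
noncomputable def jacobiMinus (a b : ℤ → ℝ) : EllTwo ℕ →ₗ.[ℂ] EllTwo ℕ :=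
  jacobiHalfLine (fun k => a (-(k : ℤ) - 2)) (fun k => b (-(k : ℤ) - 1))

/-! A vector of the deficiency space at `z` is a square summable solution of the three-term
recurrence. On a half-line, solutions are parametrised by `(u 0, c)`, where `c` is the term entering
the equation at site `0` from outside; let `V ⊆ ℂ²` be the data of square summable solutions. The
half-line deficiency space corresponds to `V` intersected with the line `c = 0`.

For nonreal `z`, Weyl's nested compactness argument (`exists_weyl_solution_mem`) gives a vector of
`V` with `c ≠ 0`. So `V` has dimension 1 plus the half-line index.

Cutting the line between `-1` and `0` identifies the deficiency space of `L` with `V⁺ ∩ V⁻` in the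
coordinates `(u 0, u (-1))`. If either space is all of `ℂ²`, the intersection has dimension `n(J⁺) +
n(J⁻)`. If both are lines, each satisfies a Weyl inequality, and their right-hand sides are
opposite, so the intersection is zero (`weyl_inequality_of_notMem`). Essential self-adjointness then
follows from von Neumann's criterion. -/

section Unbounded

/-! ### Von Neumann's criterion for essential self-adjointness. -/

variable {H : Type*} [NormedAddCommGroup H] [InnerProductSpace ℂ H] [CompleteSpace H]

theorem LinearPMap.IsFormalAdjoint.isClosable {T : H →ₗ.[ℂ] H} (hT : Dense (T.domain : Set H))
    (hs : T.IsFormalAdjoint T) : T.IsClosable :=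
  (LinearPMap.adjoint_isClosed hT).isClosable.leIsClosable (hs.le_adjoint hT)

/-- The adjoint relation with a fixed pair is a closed condition, so it extends from the graph of
`T` to its closure. -/
theorem LinearPMap.adjoint_graph_le_adjoint_closure_graph {T : H →ₗ.[ℂ] H}
    (hT : Dense (T.domain : Set H)) (hc : T.IsClosable) :
    T†.graph ≤ T.closure†.graph := by
  rw [LinearPMap.adjoint_graph_eq_graph_adjoint hT,
    LinearPMap.adjoint_graph_eq_graph_adjoint (hT.mono T.le_closure.1)]
  rintro ⟨x, y⟩ hx
  rw [Submodule.mem_adjoint_iff] at hx ⊢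
  intro a b hab
  rw [← hc.graph_closure_eq_closure_graph] at hab
  have hcl : _root_.IsClosed {p : H × H | inner ℂ p.2 x - inner ℂ p.1 y = 0} :=
    isClosed_eq (by fun_prop) continuous_const
  exact closure_minimal (fun p hp => hx p.1 p.2 hp) hcl hab

/-- A deficiency vector is an eigenvector of the self-adjoint closure; pairing it with itself forces
a real eigenvalue. -/
theorem deficiencySpace_eq_bot_of_isSelfAdjoint_closure {T : H →ₗ.[ℂ] H}
    (hT : Dense (T.domain : Set H)) (hs : T.IsFormalAdjoint T) (h : IsSelfAdjoint T.closure)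
    {z : ℂ} (hz : z.im ≠ 0) : deficiencySpace T z = ⊥ := by
  rw [Submodule.eq_bot_iff]
  intro v hv
  rw [mem_deficiencySpace] at hv
  have h1 : ((v : H), T† v) ∈ T.closure†.graph :=
    LinearPMap.adjoint_graph_le_adjoint_closure_graph hT (hs.isClosable hT)
      (LinearPMap.mem_graph _ v)
  have h2 := h1
  rw [LinearPMap.isSelfAdjoint_def.1 h] at h2
  rw [LinearPMap.adjoint_graph_eq_graph_adjoint (hT.mono T.le_closure.1),
    Submodule.mem_adjoint_iff] at h1
  have h3 := h1 _ _ h2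
  simp only [hv, inner_smul_left, inner_smul_right] at h3
  rw [← sub_mul, mul_eq_zero, inner_self_eq_zero] at h3
  rcases h3 with h3 | h3
  · refine absurd ?_ hz
    have := congrArg Complex.im h3
    simp at this
    linarith
  · exact Subtype.ext h3

theorem isSelfAdjoint_closure_of_deficiencySpace_eq_bot {T : H →ₗ.[ℂ] H}
    (hT : Dense (T.domain : Set H)) (hs : T.IsFormalAdjoint T)
    (h₁ : deficiencySpace T Complex.I = ⊥) (h₂ : deficiencySpace T (-Complex.I) = ⊥) :
    IsSelfAdjoint T.closure := by
  have hc := hs.isClosable hT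
  have hd : Dense (T.closure.domain : Set H) := hT.mono T.le_closure.1
  have hle : T.closure.graph ≤ T†.graph := by
    rw [← hc.graph_closure_eq_closure_graph]
    exact Submodule.topologicalClosure_minimal _ (LinearPMap.le_graph_of_le (hs.le_adjoint hT))
      (LinearPMap.adjoint_isClosed hT)
  have key : T†.graph ≤ T.closure.graph := by
    -- The `L²` product makes the closed graph a subspace of a Hilbert space, so orthogonal
    -- projection is available.
    let K : Submodule ℂ (WithLp 2 (H × H)) :=
      T.closure.graph.comap (WithLp.linearEquiv 2 ℂ (H × H)).toLinearMap
    have hK : _root_.IsClosed (K : Set (WithLp 2 (H × H))) :=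
      hc.closure_isClosed.preimage (WithLp.prod_continuous_ofLp 2 H H)
    have : CompleteSpace K := hK.completeSpace_coe
    intro g hg
    obtain ⟨k, hk, l, hl, hkl⟩ := K.exists_add_mem_mem_orthogonal (WithLp.toLp 2 g)
    have hk' : k.ofLp ∈ T.closure.graph := hk
    have hg' : g = k.ofLp + l.ofLp := congrArg WithLp.ofLp hkl
    have hlg : l.ofLp ∈ T†.graph := by
      have : l.ofLp = g - k.ofLp := by rw [hg']; abel
      rw [this]
      exact Submodule.sub_mem _ hg (hle hk')
    -- With `l = (p, q)`, orthogonality to the graph of `T` says `T† q = -p`, while `hlg` says `T† p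
    -- = q`. Hence `q - i p` lies in `N_{-i} = 0`, and then `p` lies in `N_i = 0`.
    have horth : (l.ofLp.2, -l.ofLp.1) ∈ T†.graph := by
      rw [LinearPMap.adjoint_graph_eq_graph_adjoint hT, Submodule.mem_adjoint_iff]
      intro a b hab
      have hab' : WithLp.toLp 2 (a, b) ∈ K := LinearPMap.le_graph_of_le T.le_closure hab
      have := (Submodule.mem_orthogonal _ _).1 hl _ hab'
      rw [WithLp.prod_inner_apply] at this
      simp only [inner_neg_right, sub_neg_eq_add]
      rw [add_comm]
      exact this
    have hzero : ∀ z : ℂ, deficiencySpace T z = ⊥ → ∀ x : H, (x, z • x) ∈ T†.graph → x = 0 := by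
      intro z hz x hx
      obtain ⟨y, hy1, hy2⟩ := (LinearPMap.mem_graph_iff _).1 hx
      have hy : y ∈ deficiencySpace T z := by
        rw [mem_deficiencySpace, hy2]
        simp only at hy1 ⊢
        rw [hy1]
      rw [hz, Submodule.mem_bot] at hy
      simpa [hy] using hy1.symm
    have e1 : l.ofLp.2 - Complex.I • l.ofLp.1 = 0 := by
      apply hzero _ h₂
      have := Submodule.sub_mem _ horth (Submodule.smul_mem _ Complex.I hlg)
      convert this using 1
      ext
      · rfl
      · simp [smul_sub, smul_smul]
        abel
    have e2 : l.ofLp.1 = 0 := by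
      apply hzero _ h₁
      rw [← sub_eq_zero.1 e1]
      exact hlg
    have e3 : l.ofLp = 0 := by
      rw [e2, smul_zero, sub_zero] at e1
      exact Prod.ext e2 e1
    rw [hg', e3, add_zero]
    exact hk'
  rw [LinearPMap.isSelfAdjoint_def]
  apply LinearPMap.eq_of_eq_graph
  apply le_antisymm
  · refine le_trans ?_ key
    rw [LinearPMap.adjoint_graph_eq_graph_adjoint hT,
      LinearPMap.adjoint_graph_eq_graph_adjoint hd]
    intro x hx
    rw [Submodule.mem_adjoint_iff] at hx ⊢
    exact fun a b hab => hx a b (LinearPMap.le_graph_of_le T.le_closure hab)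
  · exact hle.trans (LinearPMap.adjoint_graph_le_adjoint_closure_graph hT hc)

theorem isEssentiallySelfAdjoint_iff {H : Type} [NormedAddCommGroup H] [InnerProductSpace ℂ H]
    [CompleteSpace H] {T : H →ₗ.[ℂ] H} (hT : Dense (T.domain : Set H))
    (hs : T.IsFormalAdjoint T) :
    IsEssentiallySelfAdjoint T ↔ deficiencyIndices T = 0 := by
  rw [deficiencyIndices, Prod.mk_eq_zero, Submodule.rank_eq_zero, Submodule.rank_eq_zero]
  constructor
  · intro h
    exact ⟨deficiencySpace_eq_bot_of_isSelfAdjoint_closure hT hs h.closure_selfAdjoint (by simp),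
      deficiencySpace_eq_bot_of_isSelfAdjoint_closure hT hs h.closure_selfAdjoint (by simp)⟩
  · rintro ⟨h₁, h₂⟩
    exact ⟨hT, hs, isSelfAdjoint_closure_of_deficiencySpace_eq_bot hT hs h₁ h₂⟩

end Unbounded

/-! ### The half-line recurrence and Weyl's theorem. -/

/-- The value at `k` of the solution `u` of the half-line Jacobi recurrence with spectral
parameter `z`, as a linear function of the initial data `(u 0, c)`, where
`a 0 * u 1 + b 0 * u 0 + c = z * u 0`. -/
noncomputable def jacobiSol (a b : ℕ → ℝ) (z : ℂ) : ℕ → (ℂ × ℂ →ₗ[ℂ] ℂ)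
  | 0 => LinearMap.fst ℂ ℂ ℂ
  | 1 => (a 0 : ℂ)⁻¹ • ((z - b 0) • LinearMap.fst ℂ ℂ ℂ - LinearMap.snd ℂ ℂ ℂ)
  | k + 2 => (a (k + 1) : ℂ)⁻¹ •
      ((z - b (k + 1)) • jacobiSol a b z (k + 1) - (a k : ℂ) • jacobiSol a b z k)

/-- The initial data whose solution of the half-line Jacobi recurrence is square summable. -/
noncomputable def jacobiSqSummable (a b : ℕ → ℝ) (z : ℂ) : Submodule ℂ (ℂ × ℂ) where
  carrier := {w | Memℓp (fun k => jacobiSol a b z k w) 2}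
  add_mem' {v w} hv hw := by
    have h := Memℓp.add hv hw
    simp only [Set.mem_ofPred_eq, map_add]
    exact h
  zero_mem' := by
    simp only [Set.mem_ofPred_eq, map_zero]
    exact zero_memℓp
  smul_mem' c w hw := by
    have h := Memℓp.const_smul hw c
    simp only [Set.mem_ofPred_eq, map_smul]
    exact h

section HalfLine

variable {a b : ℕ → ℝ} {z : ℂ}

theorem mem_jacobiSqSummable {w : ℂ × ℂ} :
    w ∈ jacobiSqSummable a b z ↔ Memℓp (fun k => jacobiSol a b z k w) 2 := Iff.rfl

@[simp]
theorem jacobiSol_zero (w : ℂ × ℂ) : jacobiSol a b z 0 w = w.1 := rfl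

theorem jacobiSol_one (ha : ∀ k, 0 < a k) (w : ℂ × ℂ) :
    a 0 * jacobiSol a b z 1 w = (z - b 0) * w.1 - w.2 := by
  have : (a 0 : ℂ) ≠ 0 := by exact_mod_cast (ha 0).ne'
  simp [jacobiSol, this]

theorem jacobiSol_add_two (ha : ∀ k, 0 < a k) (k : ℕ) (w : ℂ × ℂ) :
    a (k + 1) * jacobiSol a b z (k + 2) w =
      (z - b (k + 1)) * jacobiSol a b z (k + 1) w - a k * jacobiSol a b z k w := by
  have : (a (k + 1) : ℂ) ≠ 0 := by exact_mod_cast (ha (k + 1)).ne'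
  rw [jacobiSol]
  simp [this]

theorem eq_jacobiSol (ha : ∀ k, 0 < a k) {u : ℕ → ℂ} {w : ℂ × ℂ} (h0 : u 0 = w.1)
    (h1 : a 0 * u 1 + b 0 * u 0 + w.2 = z * u 0)
    (h2 : ∀ k, a (k + 1) * u (k + 2) + b (k + 1) * u (k + 1) + a k * u k = z * u (k + 1)) (k : ℕ) :
    u k = jacobiSol a b z k w := by
  have hne : ∀ k, (a k : ℂ) ≠ 0 := fun k => by exact_mod_cast (ha k).ne'
  induction k using Nat.twoStepInduction with
  | zero => exact h0
  | one =>
    apply mul_left_cancel₀ (hne 0)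
    rw [jacobiSol_one ha, ← h0]
    linear_combination h1
  | more k ih1 ih2 =>
    apply mul_left_cancel₀ (hne (k + 1))
    rw [jacobiSol_add_two ha, ← ih1, ← ih2]
    linear_combination h2 k

/-- Green's identity. -/
theorem jacobiSol_green (ha : ∀ k, 0 < a k) (w : ℂ × ℂ) (N : ℕ) :
    z.im * ∑ k ∈ Finset.range (N + 1), Complex.normSq (jacobiSol a b z k w) =
      a N * (starRingEnd ℂ (jacobiSol a b z N w) * jacobiSol a b z (N + 1) w).im +
        (starRingEnd ℂ w.1 * w.2).im := by
  induction N with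
  | zero =>
    have h := congrArg (fun t => (starRingEnd ℂ w.1 * t).im) (jacobiSol_one (b := b) (z := z) ha w)
    simp [Complex.normSq_apply] at h ⊢
    linear_combination -h
  | succ N ih =>
    rw [Finset.sum_range_succ, mul_add, ih]
    -- Pair the recurrence with the conjugate of `u (N + 1)`: the real coefficient `b` drops out and
    -- the `a N` term cancels the old boundary term.
    have h := congrArg (fun t => (starRingEnd ℂ (jacobiSol a b z (N + 1) w) * t).im)
      (jacobiSol_add_two (b := b) (z := z) ha N w)
    simp [Complex.normSq_apply] at h ⊢
    linear_combination -h

/-- Weyl's theorem: there is a nonzero solution satisfying the limiting Weyl disc inequality. -/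
theorem exists_weyl_solution (ha : ∀ k, 0 < a k) (z : ℂ) :
    ∃ w : ℂ × ℂ, w ≠ 0 ∧ ∀ N,
      z.im ^ 2 * ∑ k ∈ Finset.range (N + 1), Complex.normSq (jacobiSol a b z k w) ≤
        z.im * (starRingEnd ℂ w.1 * w.2).im := by
  have hcont : ∀ k, Continuous (jacobiSol a b z k) := fun k =>
    LinearMap.continuous_of_finiteDimensional _
  -- The extra factor `z.im` on both sides treats both signs of `z.im` at once.
  let S : ℕ → Set (ℂ × ℂ) := fun N => Metric.sphere 0 1 ∩ {w |
      z.im ^ 2 * ∑ k ∈ Finset.range (N + 1), Complex.normSq (jacobiSol a b z k w) ≤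
        z.im * (starRingEnd ℂ w.1 * w.2).im}
  have hclosed : ∀ N, IsClosed (S N) := fun N => by
    refine Metric.isClosed_sphere.inter (isClosed_le ?_ ?_)
    · exact continuous_const.mul (continuous_finsetSum _ fun k _ =>
        Complex.continuous_normSq.comp (hcont k))
    · exact continuous_const.mul (Complex.continuous_im.comp
        ((Complex.continuous_conj.comp continuous_fst).mul continuous_snd))
  have hne : ∀ N, (S N).Nonempty := fun N => by
    -- A solution vanishing at `N + 1` kills the boundary term in Green's identity, giving equality.
    have hker : LinearMap.ker (jacobiSol a b z (N + 1)) ≠ ⊥ :=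
      LinearMap.ker_ne_bot_of_finrank_lt (by simp)
    obtain ⟨v, hv, hv0⟩ := (Submodule.ne_bot_iff _).1 hker
    have hn : ‖v‖ ≠ 0 := norm_ne_zero_iff.2 hv0
    refine ⟨((‖v‖⁻¹ : ℝ) : ℂ) • v, ?_, ?_⟩
    · simp [norm_smul, hn]
    · have hw : ((‖v‖⁻¹ : ℝ) : ℂ) • v ∈ LinearMap.ker (jacobiSol a b z (N + 1)) :=
        Submodule.smul_mem _ _ hv
      rw [LinearMap.mem_ker] at hw
      have h := jacobiSol_green (b := b) (z := z) ha (((‖v‖⁻¹ : ℝ) : ℂ) • v) N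
      rw [hw, mul_zero, Complex.zero_im, mul_zero, zero_add] at h
      rw [Set.mem_ofPred_eq, pow_two, mul_assoc, h]
  have hmono : ∀ N, S (N + 1) ⊆ S N := by
    rintro N w ⟨hw1, hw2⟩
    refine ⟨hw1, ?_⟩
    rw [Set.mem_ofPred_eq] at hw2 ⊢
    refine le_trans ?_ hw2
    refine mul_le_mul_of_nonneg_left ?_ (sq_nonneg _)
    rw [Finset.sum_range_succ _ (N + 1)]
    exact le_add_of_nonneg_right (Complex.normSq_nonneg _)
  obtain ⟨w, hw⟩ := IsCompact.nonempty_iInter_of_sequence_nonempty_isCompact_isClosed S hmono hne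
    ((isCompact_sphere _ _).of_isClosed_subset (hclosed 0) Set.inter_subset_left) hclosed
  rw [Set.mem_iInter] at hw
  refine ⟨w, ?_, fun N => (hw N).2⟩
  rintro rfl
  simpa using (hw 0).1

theorem exists_weyl_solution_mem (ha : ∀ k, 0 < a k) (hz : z.im ≠ 0) :
    ∃ w ∈ jacobiSqSummable a b z, w.2 ≠ 0 ∧
      z.im ^ 2 * Complex.normSq w.1 ≤ z.im * (starRingEnd ℂ w.1 * w.2).im := by
  obtain ⟨w, hw0, hw⟩ := exists_weyl_solution (b := b) ha z
  have hz2 : 0 < z.im ^ 2 := by positivity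
  have h0 : z.im ^ 2 * Complex.normSq w.1 ≤ z.im * (starRingEnd ℂ w.1 * w.2).im := by
    simpa using hw 0
  refine ⟨w, ?_, ?_, h0⟩
  · rw [mem_jacobiSqSummable]
    apply memℓp_gen' (C := (z.im * (starRingEnd ℂ w.1 * w.2).im) / z.im ^ 2)
    intro s
    obtain ⟨N, hN⟩ := s.exists_nat_subset_range
    rw [le_div_iff₀ hz2, mul_comm]
    refine le_trans (mul_le_mul_of_nonneg_left ?_ hz2.le) (hw N)
    calc _ = ∑ k ∈ s, Complex.normSq (jacobiSol a b z k w) := by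
          simp [Complex.normSq_eq_norm_sq]
      _ ≤ _ := Finset.sum_le_sum_of_subset_of_nonneg
          (hN.trans (Finset.range_mono (Nat.le_succ N))) fun _ _ _ => Complex.normSq_nonneg _
  · intro h2
    apply hw0
    rw [h2, mul_zero, Complex.zero_im, mul_zero] at h0
    have : Complex.normSq w.1 = 0 :=
      le_antisymm (nonpos_of_mul_nonpos_right h0 hz2) (Complex.normSq_nonneg _)
    exact Prod.ext (Complex.normSq_eq_zero.1 this) h2

/-- If the solution satisfying the boundary condition is not square summable, then all square
summable solutions satisfy the Weyl disc inequality. -/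
theorem weyl_inequality_of_notMem (ha : ∀ k, 0 < a k) (hz : z.im ≠ 0)
    (h : ((1, 0) : ℂ × ℂ) ∉ jacobiSqSummable a b z) {w : ℂ × ℂ}
    (hw : w ∈ jacobiSqSummable a b z) :
    z.im ^ 2 * Complex.normSq w.1 ≤ z.im * (starRingEnd ℂ w.1 * w.2).im := by
  obtain ⟨v, hv, hv2, hle⟩ := exists_weyl_solution_mem (b := b) ha hz
  have hd := Submodule.sub_mem _ hw (Submodule.smul_mem _ (w.2 / v.2) hv)
  -- Otherwise `w - (w.2 / v.2) • v` would be a nonzero multiple of `(1, 0)`. So `w` is a multiple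
  -- `c • v`, and both sides of the inequality scale by `|c|²`.
  have hd1 : w.1 = w.2 / v.2 * v.1 := by
    by_contra hne
    apply h
    have := Submodule.smul_mem _ (w.1 - w.2 / v.2 * v.1)⁻¹ hd
    convert this using 1
    ext
    · simp [inv_mul_cancel₀ (sub_ne_zero.2 hne)]
    · simp [hv2]
  have hd2 : w.2 = w.2 / v.2 * v.2 := by rw [div_mul_cancel₀ _ hv2]
  generalize w.2 / v.2 = c at hd1 hd2
  have e : starRingEnd ℂ w.1 * w.2 = (Complex.normSq c : ℝ) * (starRingEnd ℂ v.1 * v.2) := by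
    rw [hd1, hd2, map_mul, Complex.normSq_eq_conj_mul_self]
    ring
  rw [e, Complex.im_ofReal_mul, hd1, map_mul]
  nlinarith [mul_le_mul_of_nonneg_left hle (Complex.normSq_nonneg c)]

end HalfLine

/-! ### Deficiency vectors as coordinatewise solutions. -/

namespace EllTwo

variable {ι : Type} [DecidableEq ι] {A : ι → EllTwo ι}

theorem inner_opOfBasis_ext {v w : EllTwo ι} (h : ∀ k, inner ℂ w (e k) = inner ℂ v (A k))
    (x : (opOfBasis A).domain) : inner ℂ w (x : EllTwo ι) = inner ℂ v (opOfBasis A x) := by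
  obtain ⟨x, hx⟩ := x
  induction hx using Submodule.span_induction with
  | mem x hx =>
    obtain ⟨k, rfl⟩ := hx
    rw [opOfBasis_e]
    exact h k
  | zero =>
    have : (⟨0, Submodule.zero_mem _⟩ : (opOfBasis A).domain) = 0 := rfl
    rw [this, LinearPMap.map_zero]
    simp
  | add x y hx hy ihx ihy =>
    have : (⟨x + y, Submodule.add_mem _ hx hy⟩ : (opOfBasis A).domain) = ⟨x, hx⟩ + ⟨y, hy⟩ := rfl
    rw [this, LinearPMap.map_add, inner_add_right, ← ihx, ← ihy]
    exact inner_add_right _ _ _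
  | smul c x hx ih =>
    have : (⟨c • x, Submodule.smul_mem _ c hx⟩ : (opOfBasis A).domain) = c • ⟨x, hx⟩ := rfl
    rw [this, LinearPMap.map_smul, inner_smul_right, ← ih]
    exact inner_smul_right _ _ _

theorem opOfBasis_isFormalAdjoint (h : ∀ j k, inner ℂ (A j) (e k) = inner ℂ (e j) (A k)) :
    (opOfBasis A).IsFormalAdjoint (opOfBasis A) := by
  intro x y
  refine inner_opOfBasis_ext (fun k => ?_) y
  rw [← inner_conj_symm, ← inner_conj_symm (x : EllTwo ι)]
  congr 1
  exact (inner_opOfBasis_ext (fun j => by rw [← inner_conj_symm, ← h, inner_conj_symm]) x).symm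

/-- Together with `exists_mem_deficiencySpace_opOfBasis`, this reduces the adjoint eigenvalue
equation to its tests against basis vectors. -/
theorem deficiencySpace_opOfBasis_apply {z : ℂ} {v : ((opOfBasis A)†).domain}
    (hv : v ∈ deficiencySpace (opOfBasis A) z) (k : ι) :
    inner ℂ (A k) (v : EllTwo ι) = z * (v : EllTwo ι) k := by
  rw [mem_deficiencySpace] at hv
  have h := LinearPMap.adjoint_isFormalAdjoint (dense_domain_opOfBasis A) v ⟨e k, e_mem A k⟩
  rw [opOfBasis_e, hv] at h
  rw [← inner_conj_symm, ← h, inner_conj_symm, inner_smul_right, inner_e]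

theorem exists_mem_deficiencySpace_opOfBasis {z : ℂ} {v : EllTwo ι}
    (hv : ∀ k, inner ℂ (A k) v = z * v k) :
    ∃ x ∈ deficiencySpace (opOfBasis A) z, (x : EllTwo ι) = v := by
  have h : ∀ x : (opOfBasis A).domain,
      inner ℂ (z • v) (x : EllTwo ι) = inner ℂ v (opOfBasis A x) := by
    apply inner_opOfBasis_ext
    intro k
    rw [← inner_conj_symm, inner_smul_right, inner_e, ← hv, inner_conj_symm]
  refine ⟨⟨v, LinearPMap.mem_adjoint_domain_of_exists _ ⟨_, h⟩⟩, ?_, rfl⟩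
  rw [mem_deficiencySpace]
  exact LinearPMap.adjoint_apply_eq (dense_domain_opOfBasis A) _ h

/-- The evaluation at `k` on the deficiency space. -/
noncomputable def deficiencyEval (A : ι → EllTwo ι) (z : ℂ) (k : ι) :
    deficiencySpace (opOfBasis A) z →ₗ[ℂ] ℂ where
  toFun v := ((v : ((opOfBasis A)†).domain) : EllTwo ι) k
  map_add' _ _ := rfl
  map_smul' _ _ := rfl

end EllTwo

open EllTwo

/-! ### Deficiency spaces on the half-line. -/

section HalfLine

variable {a b : ℕ → ℝ} {z : ℂ}

theorem jacobiHalfLine_isFormalAdjoint (a b : ℕ → ℝ) :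
    (jacobiHalfLine a b).IsFormalAdjoint (jacobiHalfLine a b) := by
  apply opOfBasis_isFormalAdjoint
  intro j k
  rcases j with _ | j <;> rcases k with _ | k <;>
    simp only [inner_add_left, inner_add_right, inner_smul_left, inner_smul_right, inner_e, e_apply,
      Complex.conj_ofReal] <;>
    grind

theorem jacobiHalfLine_isEssentiallySelfAdjoint_iff (a b : ℕ → ℝ) :
    IsEssentiallySelfAdjoint (jacobiHalfLine a b) ↔ deficiencyIndices (jacobiHalfLine a b) = 0 :=
  isEssentiallySelfAdjoint_iff (dense_domain_opOfBasis _) (jacobiHalfLine_isFormalAdjoint a b)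

theorem deficiencySpace_jacobiHalfLine_eq (ha : ∀ k, 0 < a k)
    {v : ((jacobiHalfLine a b)†).domain} (hv : v ∈ deficiencySpace (jacobiHalfLine a b) z) (k : ℕ) :
    (v : EllTwo ℕ) k = jacobiSol a b z k ((v : EllTwo ℕ) 0, 0) := by
  have h := deficiencySpace_opOfBasis_apply hv
  refine eq_jacobiSol (u := fun k => (v : EllTwo ℕ) k) ha rfl ?_ ?_ k
  · simpa [inner_add_left, inner_smul_left, inner_e] using h 0
  · intro k
    simpa [inner_add_left, inner_smul_left, inner_e] using h (k + 1)

theorem exists_mem_deficiencySpace_jacobiHalfLine (ha : ∀ k, 0 < a k)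
    (h : ((1, 0) : ℂ × ℂ) ∈ jacobiSqSummable a b z) :
    ∃ x ∈ deficiencySpace (jacobiHalfLine a b) z, (x : EllTwo ℕ) 0 = 1 := by
  obtain ⟨x, hx, hxv⟩ := exists_mem_deficiencySpace_opOfBasis (A := fun k => match k with
    | 0 => (a 0 : ℂ) • e 1 + (b 0 : ℂ) • e 0
    | k + 1 => (a (k + 1) : ℂ) • e (k + 2) + (b (k + 1) : ℂ) • e (k + 1) + (a k : ℂ) • e k)
    (z := z) (v := (⟨_, h⟩ : EllTwo ℕ)) (by
      rintro (_ | k)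
      · simp only [inner_add_left, inner_smul_left, inner_e, Complex.conj_ofReal, jacobiSol_zero]
        linear_combination jacobiSol_one (b := b) (z := z) ha (1, 0)
      · simp only [inner_add_left, inner_smul_left, inner_e, Complex.conj_ofReal]
        linear_combination jacobiSol_add_two (b := b) (z := z) ha k (1, 0))
  exact ⟨x, hx, by rw [hxv]; rfl⟩

open Classical in
theorem rank_deficiencySpace_jacobiHalfLine (ha : ∀ k, 0 < a k) (z : ℂ) :
    Module.rank ℂ (deficiencySpace (jacobiHalfLine a b) z) =
      if ((1, 0) : ℂ × ℂ) ∈ jacobiSqSummable a b z then 1 else 0 := by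
  split_ifs with h
  · have hinj : Function.Injective (deficiencyEval _ z 0 :
        deficiencySpace (jacobiHalfLine a b) z →ₗ[ℂ] ℂ) := by
      rw [injective_iff_map_eq_zero]
      rintro ⟨v, hv⟩ h0
      replace h0 : (v : EllTwo ℕ) 0 = 0 := h0
      apply Subtype.ext
      apply Subtype.ext
      ext k
      rw [deficiencySpace_jacobiHalfLine_eq ha hv, h0]
      exact map_zero _
    have hsurj : Function.Surjective (deficiencyEval _ z 0 :
        deficiencySpace (jacobiHalfLine a b) z →ₗ[ℂ] ℂ) := by
      obtain ⟨x, hx, hx1⟩ := exists_mem_deficiencySpace_jacobiHalfLine ha h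
      intro c
      refine ⟨c • ⟨x, hx⟩, ?_⟩
      rw [map_smul]
      exact (congrArg (c * ·) hx1).trans (mul_one c)
    exact (LinearEquiv.ofBijective _ ⟨hinj, hsurj⟩).rank_eq.trans (Module.rank_self ℂ)
  · rw [Submodule.rank_eq_zero, Submodule.eq_bot_iff]
    intro v hv
    have hsol := deficiencySpace_jacobiHalfLine_eq ha hv
    have hmem : ((v : EllTwo ℕ) 0, (0 : ℂ)) ∈ jacobiSqSummable a b z := by
      rw [mem_jacobiSqSummable]
      simp only [← hsol]
      exact lp.memℓp (v : EllTwo ℕ)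
    have h0 : (v : EllTwo ℕ) 0 = 0 := by
      by_contra hne
      apply h
      have := Submodule.smul_mem _ ((v : EllTwo ℕ) 0)⁻¹ hmem
      simpa [hne] using this
    apply Subtype.ext
    ext k
    rw [hsol, h0]
    exact map_zero _

end HalfLine

/-! ### The operator on the line, cut between `-1` and `0`. -/

section Line

variable {a b : ℤ → ℝ} {z : ℂ}

theorem jacobiLine_isFormalAdjoint (a b : ℤ → ℝ) :
    (jacobiLine a b).IsFormalAdjoint (jacobiLine a b) := by
  apply opOfBasis_isFormalAdjoint
  intro j k
  simp only [inner_add_left, inner_add_right, inner_smul_left, inner_smul_right, inner_e, e_apply,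
    Complex.conj_ofReal]
  grind

/-- The initial data `(u 0, u (-1))` whose solution of the Jacobi recurrence on the line is square
summable. -/
noncomputable def jacobiLineSqSummable (a b : ℤ → ℝ) (z : ℂ) : Submodule ℂ (ℂ × ℂ) :=
  (jacobiSqSummable (fun k => a k) (fun k => b k) z).comap
      ((LinearMap.fst ℂ ℂ ℂ).prod ((a (-1) : ℂ) • LinearMap.snd ℂ ℂ ℂ)) ⊓
    (jacobiSqSummable (fun k => a (-(k : ℤ) - 2)) (fun k => b (-(k : ℤ) - 1)) z).comap
      ((LinearMap.snd ℂ ℂ ℂ).prod ((a (-1) : ℂ) • LinearMap.fst ℂ ℂ ℂ))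

theorem mem_jacobiLineSqSummable {w : ℂ × ℂ} : w ∈ jacobiLineSqSummable a b z ↔
    (w.1, a (-1) * w.2) ∈ jacobiSqSummable (fun k => a k) (fun k => b k) z ∧
      (w.2, a (-1) * w.1) ∈
        jacobiSqSummable (fun k => a (-(k : ℤ) - 2)) (fun k => b (-(k : ℤ) - 1)) z :=
  Iff.rfl

theorem jacobiLine_isEssentiallySelfAdjoint_iff (a b : ℤ → ℝ) :
    IsEssentiallySelfAdjoint (jacobiLine a b) ↔ deficiencyIndices (jacobiLine a b) = 0 :=
  isEssentiallySelfAdjoint_iff (dense_domain_opOfBasis _) (jacobiLine_isFormalAdjoint a b)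

/-- The severed coupling `a (-1)` supplies the outside term of each half: `a (-1) * u (-1)` on the
right, `a (-1) * u 0` on the left, where site `k` is `-k - 1`. -/
theorem deficiencySpace_jacobiLine_eq (ha : ∀ k, 0 < a k)
    {v : ((jacobiLine a b)†).domain} (hv : v ∈ deficiencySpace (jacobiLine a b) z) (k : ℕ) :
    (v : EllTwo ℤ) k = jacobiSol (fun k => a k) (fun k => b k) z k
        ((v : EllTwo ℤ) 0, a (-1) * (v : EllTwo ℤ) (-1)) ∧
      (v : EllTwo ℤ) (-k - 1) =
        jacobiSol (fun k => a (-(k : ℤ) - 2)) (fun k => b (-(k : ℤ) - 1)) z k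
          ((v : EllTwo ℤ) (-1), a (-1) * (v : EllTwo ℤ) 0) := by
  have h := deficiencySpace_opOfBasis_apply hv
  simp only [inner_add_left, inner_smul_left, inner_e, Complex.conj_ofReal] at h
  constructor
  · refine eq_jacobiSol (u := fun k => (v : EllTwo ℤ) k) (fun k => ha _) rfl ?_ ?_ k
    · simpa using h 0
    · intro k
      have := h (k + 1)
      rw [add_sub_cancel_right, add_assoc (k : ℤ)] at this
      exact_mod_cast this
  · refine eq_jacobiSol (u := fun k => (v : EllTwo ℤ) (-k - 1)) (fun k => ha _) (by simp) ?_ ?_ k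
    · have := h (-1)
      have e1 : -((1 : ℕ) : ℤ) - 1 = -1 - 1 := by norm_num
      have e2 : -((0 : ℕ) : ℤ) - 1 = -1 := by norm_num
      have e3 : -((0 : ℕ) : ℤ) - 2 = -1 - 1 := by norm_num
      rw [neg_add_cancel] at this
      simp only [e1, e2, e3]
      linear_combination this
    · intro k
      have := h (-k - 2)
      have e1 : -((k + 2 : ℕ) : ℤ) - 1 = -k - 2 - 1 := by push_cast; ring
      have e2 : -((k + 1 : ℕ) : ℤ) - 1 = -k - 2 := by push_cast; ring
      have e3 : -((k + 1 : ℕ) : ℤ) - 2 = -k - 2 - 1 := by push_cast; ring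
      have e4 : -(k : ℤ) - 2 + 1 = -k - 1 := by ring
      simp only [e1, e2, e3]
      rw [e4] at this
      linear_combination this

theorem exists_mem_deficiencySpace_jacobiLine (ha : ∀ k, 0 < a k) {w : ℂ × ℂ}
    (hw : w ∈ jacobiLineSqSummable a b z) :
    ∃ x ∈ deficiencySpace (jacobiLine a b) z,
      ((x : EllTwo ℤ) 0, (x : EllTwo ℤ) (-1)) = w := by
  obtain ⟨hp, hm⟩ := mem_jacobiLineSqSummable.1 hw
  let u : ℤ → ℂ := fun k => Int.rec (motive := fun _ => ℂ)
    (fun n => jacobiSol (fun k => a k) (fun k => b k) z n (w.1, a (-1) * w.2))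
    (fun n => jacobiSol (fun k => a (-(k : ℤ) - 2)) (fun k => b (-(k : ℤ) - 1)) z n
      (w.2, a (-1) * w.1)) k
  have hu : ∀ n : ℕ,
      u n = jacobiSol (fun k => a k) (fun k => b k) z n (w.1, a (-1) * w.2) := fun n => rfl
  have hu' : ∀ n : ℕ, u (-(n + 1)) = jacobiSol (fun k => a (-(k : ℤ) - 2))
      (fun k => b (-(k : ℤ) - 1)) z n (w.2, a (-1) * w.1) := fun n => by
    rw [← Int.negSucc_eq]
  have hmem : Memℓp u 2 := by
    rw [memℓp_gen_iff (by simp)]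
    rw [mem_jacobiSqSummable, memℓp_gen_iff (by simp)] at hp hm
    apply Summable.of_nat_of_neg_add_one
    · simpa only [hu] using hp
    · simpa only [hu'] using hm
  have hrec : ∀ k, a k * u (k + 1) + b k * u k + a (k - 1) * u (k - 1) = z * u k := by
    intro k
    -- The two halves interact only at `k = 0` and `k = -1`; there `jacobiSol_one` restores the
    -- missing coupling.
    obtain ⟨n, rfl | rfl⟩ : ∃ n : ℕ, k = n ∨ k = -(n + 1) := by
      rcases k with n | n
      · exact ⟨n, Or.inl rfl⟩
      · exact ⟨n, Or.inr (Int.negSucc_eq n)⟩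
    · rcases n with _ | n
      · have h := jacobiSol_one (a := fun k => a k) (b := fun k => b k) (z := z) (fun k => ha _)
          (w.1, a (-1) * w.2)
        have h0 := hu 0
        have h1 := hu 1
        have h2 := hu' 0
        simp only [jacobiSol_zero] at h0 h2
        norm_num at h h0 h1 h2 ⊢
        rw [h0, h1, h2]
        linear_combination h
      · have h := jacobiSol_add_two (a := fun k => a k) (b := fun k => b k) (z := z)
          (fun k => ha _) n (w.1, a (-1) * w.2)
        rw [← hu, ← hu, ← hu] at h
        push_cast at h ⊢
        rw [add_sub_cancel_right, add_assoc (n : ℤ)]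
        norm_num
        linear_combination h
    · rcases n with _ | n
      · have h := jacobiSol_one (a := fun k : ℕ => a (-(k : ℤ) - 2))
          (b := fun k : ℕ => b (-(k : ℤ) - 1)) (z := z) (fun k => ha _) (w.2, a (-1) * w.1)
        have h0 := hu 0
        have h1 := hu' 1
        have h2 := hu' 0
        simp only [jacobiSol_zero] at h0 h2
        norm_num at h h0 h1 h2 ⊢
        rw [h0, h1, h2]
        linear_combination h
      · have h := jacobiSol_add_two (a := fun k : ℕ => a (-(k : ℤ) - 2))
          (b := fun k : ℕ => b (-(k : ℤ) - 1)) (z := z) (fun k => ha _) n (w.2, a (-1) * w.1)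
        rw [← hu', ← hu', ← hu'] at h
        push_cast at h ⊢
        have e1 : -((n : ℤ) + 1) - 2 = -(n + 1 + 1) - 1 := by ring
        have e2 : -((n : ℤ) + 1) - 1 = -(n + 1 + 1) := by ring
        have e3 : -((n : ℤ) + 2 + 1) = -(n + 1 + 1) - 1 := by ring
        have e4 : -(n : ℤ) - 2 = -(n + 1 + 1) := by ring
        have e5 : -((n : ℤ) + 1) = -(n + 1 + 1) + 1 := by ring
        rw [e1, e2, e3, e4, e5] at h
        linear_combination h
  obtain ⟨x, hx, hxv⟩ := exists_mem_deficiencySpace_opOfBasis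
    (A := fun k : ℤ => (a k : ℂ) • e (k + 1) + (b k : ℂ) • e k + (a (k - 1) : ℂ) • e (k - 1))
    (z := z) (v := (⟨u, hmem⟩ : EllTwo ℤ)) (by
      intro k
      simp only [inner_add_left, inner_smul_left, inner_e, Complex.conj_ofReal]
      exact hrec k)
  refine ⟨x, hx, ?_⟩
  rw [hxv]
  exact Prod.ext (hu 0) (hu' 0)

theorem rank_deficiencySpace_jacobiLine (ha : ∀ k, 0 < a k) (z : ℂ) :
    Module.rank ℂ (deficiencySpace (jacobiLine a b) z) =
      Module.rank ℂ (jacobiLineSqSummable a b z) := by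
  let f : deficiencySpace (jacobiLine a b) z →ₗ[ℂ] ℂ × ℂ :=
    (deficiencyEval _ z 0).prod (deficiencyEval _ z (-1))
  have hinj : Function.Injective f := by
    rw [injective_iff_map_eq_zero]
    rintro ⟨v, hv⟩ h0
    have h1 : (v : EllTwo ℤ) 0 = 0 := congrArg Prod.fst h0
    have h2 : (v : EllTwo ℤ) (-1) = 0 := congrArg Prod.snd h0
    apply Subtype.ext
    apply Subtype.ext
    ext k
    have h := deficiencySpace_jacobiLine_eq ha hv
    simp only [h1, h2, mul_zero, Prod.mk_zero_zero, map_zero] at h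
    rcases k with n | n
    · exact (h n).1
    · rw [Int.negSucc_eq, neg_add']
      exact (h n).2
  have hrange : LinearMap.range f = jacobiLineSqSummable a b z := by
    ext w
    constructor
    · rintro ⟨⟨v, hv⟩, rfl⟩
      have h := deficiencySpace_jacobiLine_eq ha hv
      have hv2 := lp.memℓp (v : EllTwo ℤ)
      rw [memℓp_gen_iff (by simp)] at hv2
      rw [mem_jacobiLineSqSummable, mem_jacobiSqSummable, mem_jacobiSqSummable]
      constructor
      · refine Eq.subst (motive := fun g => Memℓp g 2) (funext fun k => (h k).1) ?_
        rw [memℓp_gen_iff (by simp)]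
        exact hv2.comp_injective Nat.cast_injective
      · refine Eq.subst (motive := fun g => Memℓp g 2) (funext fun k => (h k).2) ?_
        rw [memℓp_gen_iff (by simp)]
        exact hv2.comp_injective (i := fun k : ℕ => -(k : ℤ) - 1) fun i j hij => by
          simpa using hij
    · intro hw
      obtain ⟨x, hx, hxw⟩ := exists_mem_deficiencySpace_jacobiLine ha hw
      exact ⟨⟨x, hx⟩, hxw⟩
  rw [(LinearEquiv.ofInjective f hinj).rank_eq, hrange]

/-- The Weyl solution has nonzero second coordinate, so with `(1, 0)` it spans `ℂ²`. -/
theorem jacobiSqSummable_eq_top {a b : ℕ → ℝ} (ha : ∀ k, 0 < a k) (hz : z.im ≠ 0)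
    (h : ((1, 0) : ℂ × ℂ) ∈ jacobiSqSummable a b z) : jacobiSqSummable a b z = ⊤ := by
  obtain ⟨v, hv, hv2, -⟩ := exists_weyl_solution_mem (b := b) ha hz
  rw [Submodule.eq_top_iff']
  intro w
  have := Submodule.add_mem _ (Submodule.smul_mem _ (w.2 / v.2) hv)
    (Submodule.smul_mem _ (w.1 - w.2 / v.2 * v.1) h)
  convert this using 1
  ext <;> simp [hv2]

/-- A submodule on which some linear functional is injective and nonzero is a line. -/
theorem rank_eq_one_of_linearFunctional {P : Submodule ℂ (ℂ × ℂ)} {f : ℂ × ℂ →ₗ[ℂ] ℂ}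
    {v : ℂ × ℂ} (hv : v ∈ P) (hfv : f v ≠ 0) (hP : ∀ w ∈ P, f w = 0 → w = 0) :
    Module.rank ℂ P = 1 := by
  have hinj : Function.Injective (f.domRestrict P) := by
    rw [injective_iff_map_eq_zero]
    exact fun w hw => Subtype.ext (hP w w.2 hw)
  have hsurj : Function.Surjective (f.domRestrict P) := fun c =>
    ⟨(c / f v) • ⟨v, hv⟩, by rw [map_smul]; exact div_mul_cancel₀ c hfv⟩
  rw [(LinearEquiv.ofBijective _ ⟨hinj, hsurj⟩).rank_eq, Module.rank_self]

theorem rank_deficiencySpace_jacobiLine_eq_add (ha : ∀ k, 0 < a k) (hz : z.im ≠ 0) :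
    Module.rank ℂ (deficiencySpace (jacobiLine a b) z) =
      Module.rank ℂ (deficiencySpace (jacobiPlus a b) z) +
        Module.rank ℂ (deficiencySpace (jacobiMinus a b) z) := by
  have hα : (a (-1) : ℂ) ≠ 0 := by exact_mod_cast (ha _).ne'
  have ha₁ : ∀ k : ℕ, 0 < (fun k : ℕ => a k) k := fun k => ha _
  have ha₂ : ∀ k : ℕ, 0 < (fun k : ℕ => a (-(k : ℤ) - 2)) k := fun k => ha _
  rw [rank_deficiencySpace_jacobiLine ha, jacobiPlus, jacobiMinus,
    rank_deficiencySpace_jacobiHalfLine ha₁, rank_deficiencySpace_jacobiHalfLine ha₂]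
  have hmem := fun w => mem_jacobiLineSqSummable (a := a) (b := b) (z := z) (w := w)
  generalize jacobiLineSqSummable a b z = P at hmem
  split_ifs with h₁ h₂ h₂
  · have : P = ⊤ := by
      rw [Submodule.eq_top_iff']
      intro w
      rw [hmem, jacobiSqSummable_eq_top ha₁ hz h₁, jacobiSqSummable_eq_top ha₂ hz h₂]
      exact ⟨trivial, trivial⟩
    rw [this, rank_top]
    simp
  · obtain ⟨v, hv, hv2, -⟩ :=
      exists_weyl_solution_mem (b := fun k : ℕ => b (-(k : ℤ) - 1)) ha₂ hz
    rw [add_zero]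
    -- The witness is chosen so that its left data `(w.2, a (-1) * w.1)` is the Weyl vector `v`. If
    -- `w.1 = 0`, the left data is a multiple of `(1, 0)`, which `h₂` forces to vanish.
    refine rank_eq_one_of_linearFunctional (f := LinearMap.fst ℂ ℂ ℂ) (v := (v.2 / a (-1), v.1)) ?_ ?_ ?_
    · rw [hmem, jacobiSqSummable_eq_top ha₁ hz h₁]
      exact ⟨trivial, by simpa [mul_div_cancel₀, hα] using hv⟩
    · simpa [hα] using hv2
    · rintro ⟨x, y⟩ hw h0
      replace h0 : x = 0 := h0
      subst h0
      by_contra hne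
      have hy : y ≠ 0 := fun h => hne (by rw [h]; rfl)
      apply h₂
      have := Submodule.smul_mem _ y⁻¹ ((hmem _).1 hw).2
      simpa [hy] using this
  · obtain ⟨v, hv, hv2, -⟩ := exists_weyl_solution_mem (b := fun k : ℕ => b k) ha₁ hz
    rw [zero_add]
    refine rank_eq_one_of_linearFunctional (f := LinearMap.snd ℂ ℂ ℂ) (v := (v.1, v.2 / a (-1))) ?_ ?_ ?_
    · rw [hmem, jacobiSqSummable_eq_top ha₂ hz h₂]
      exact ⟨by simpa [mul_div_cancel₀, hα] using hv, trivial⟩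
    · simpa [hα] using hv2
    · rintro ⟨x, y⟩ hw h0
      replace h0 : y = 0 := h0
      subst h0
      by_contra hne
      have hx : x ≠ 0 := fun h => hne (by rw [h]; rfl)
      apply h₁
      have := Submodule.smul_mem _ x⁻¹ ((hmem _).1 hw).1
      simpa [hx] using this
  · rw [add_zero, Submodule.rank_eq_zero, Submodule.eq_bot_iff]
    rintro ⟨x, y⟩ hw
    obtain ⟨hp, hm⟩ := (hmem _).1 hw
    have i₁ := weyl_inequality_of_notMem ha₁ hz h₁ hp
    have i₂ := weyl_inequality_of_notMem ha₂ hz h₂ hm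
    have hz2 : 0 < z.im ^ 2 := by positivity
    -- The two halves see the same boundary flux with opposite signs, so adding the Weyl
    -- inequalities leaves `|x|² + |y|² ≤ 0`.
    have hsum : (starRingEnd ℂ y * (a (-1) * x)).im = -(starRingEnd ℂ x * (a (-1) * y)).im := by
      simp
      ring
    simp only [hsum] at i₁ i₂
    have i₃ : z.im ^ 2 * (Complex.normSq x + Complex.normSq y) ≤ 0 := by linarith
    have i₄ := nonpos_of_mul_nonpos_right i₃ hz2
    have hx := Complex.normSq_nonneg x
    have hy := Complex.normSq_nonneg y
    exact Prod.ext (Complex.normSq_eq_zero.1 (by linarith)) (Complex.normSq_eq_zero.1 (by linarith))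

end Line

theorem theorem4p2p5 (a b : ℤ → ℝ) (ha : ∀ k, 0 < a k) :
    deficiencyIndices (jacobiLine a b) =
        deficiencyIndices (jacobiPlus a b) + deficiencyIndices (jacobiMinus a b) ∧
      (IsEssentiallySelfAdjoint (jacobiLine a b) ↔
        IsEssentiallySelfAdjoint (jacobiPlus a b) ∧
          IsEssentiallySelfAdjoint (jacobiMinus a b)) := by
  have h : deficiencyIndices (jacobiLine a b) =
      deficiencyIndices (jacobiPlus a b) + deficiencyIndices (jacobiMinus a b) :=
    Prod.ext (rank_deficiencySpace_jacobiLine_eq_add ha (by simp))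
      (rank_deficiencySpace_jacobiLine_eq_add ha (by simp))
  refine ⟨h, ?_⟩
  rw [jacobiLine_isEssentiallySelfAdjoint_iff, jacobiPlus, jacobiMinus,
    jacobiHalfLine_isEssentiallySelfAdjoint_iff, jacobiHalfLine_isEssentiallySelfAdjoint_iff, h]
  -- A sum of cardinals vanishes only if both terms do, so no cancellation can occur.
  exact add_eq_zero
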